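/- Let $H$ be a complex Hilbert space (necessarily separable and infinite-dimensional under the hypotheses below), and let $\{f_n\}_{n\in\mathbb{N}_0}\subset H$, $\mathbb{N}_0=\{0,1,2,\dots\}$, be a linearly independent frame for $H$; that is, the $f_n$ are linearly independent and there are constants $0<C_1\le C_2$ with $$C_1\|f\|^2\le\sum_{n\ge 0}|\langle f,f_n\rangle|^2\le C_2\|f\|^2\qquad\text{for all } f\in H .$$ Let $U:\ell^2(\mathbb{N}_0)\to H$, $U\{c_n\}=\sum_{n\ge 0}c_nf_n$, be its synthesis operator, $N_U=\ker U$, and let $S(x_0,x_1,\dots)=(0,x_0,x_1,\dots)$ be the right shift on $\ell^2(\mathbb{N}_0)$. For $c\in\ell^2(\mathbb{N}_0)$ let $V(c)$ be the function $z\mapsto\sum_{n\ge 0}c_nz^n$ on the open unit disk $\mathbb{D}$; the Hardy–Hilbert space $H^2(\mathbb{D})$ consists of the analytic functions on $\mathbb{D}$ whose power series have square-summable coefficients. An inner function is a function in $H^2(\mathbb{D})$ whose radial boundary values exist and have modulus $1$ at almost every point of the unit circle. A Riesz basis of $H$ is a family $\{Ae_n\}_{n\in\mathbb{N}_0}$ with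 $\{e_n\}_{n\in\mathbb{N}_0}$ an orthonormal basis of $H$ and $A:H\to H$ a bounded linear bijection. Then the following are equivalent: (i) there is a bounded linear operator $T:H\to H$ with $f_n=T^nf_0$ for all $n\ge 0$; (ii) $\{f_n\}_{n\in\mathbb{N}_0}$ is a Riesz basis of $H$, or there is $c\in\ell^2(\mathbb{N}_0)$ such that $V(c)$ is an inner function and $N_U=\overline{\operatorname{span}}\{S^nc:n\ge 0\}$. -/

import Mathlib

open Set Filter Topology MeasureTheory

noncomputable section

/-- The sequence `f` is a frame for `H`, with the series in the frame condition converging. -/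
def IsFrame {H : Type*} [NormedAddCommGroup H] [InnerProductSpace ℂ H] (f : ℕ → H) : Prop :=
  ∃ C₁ C₂ : ℝ, 0 < C₁ ∧ C₁ ≤ C₂ ∧ ∀ x : H,
    Summable (fun n => ‖inner ℂ x (f n)‖ ^ 2) ∧
    C₁ * ‖x‖ ^ 2 ≤ ∑' n, ‖inner ℂ x (f n)‖ ^ 2 ∧
    ∑' n, ‖inner ℂ x (f n)‖ ^ 2 ≤ C₂ * ‖x‖ ^ 2

/-- The sequence `f` is a Riesz basis for `H`: the image of an orthonormal basis of `H` under a
bounded linear bijection of `H`. -/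
def IsRieszBasis {H : Type*} [NormedAddCommGroup H] [InnerProductSpace ℂ H] (f : ℕ → H) : Prop :=
  ∃ (e : HilbertBasis ℕ ℂ H) (A : H →L[ℂ] H), Function.Bijective A ∧ ∀ n, f n = A (e n)

/-- The Hilbert space of square-summable complex sequences indexed by `ℕ = {0, 1, 2, …}`. -/
abbrev EllTwo : Type := lp (fun _ : ℕ => ℂ) 2

theorem EllTwo.hasSum_sq (c : EllTwo) : HasSum (fun n => ‖c n‖ ^ 2) (‖c‖ ^ 2) := by
  have h := lp.hasSum_norm (p := 2) (by norm_num) c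
  simpa using h

/-- Finite sums against a Bessel sequence are controlled by the coefficients. -/
theorem norm_sum_smul_sq_le {H : Type*} [NormedAddCommGroup H] [InnerProductSpace ℂ H]
    {f : ℕ → H} {C : ℝ} (hC : 0 ≤ C)
    (hf : ∀ x : H, Summable (fun n => ‖inner ℂ x (f n)‖ ^ 2) ∧
      ∑' n, ‖inner ℂ x (f n)‖ ^ 2 ≤ C * ‖x‖ ^ 2)
    (c : ℕ → ℂ) (s : Finset ℕ) :
    ‖∑ n ∈ s, c n • f n‖ ^ 2 ≤ C * ∑ n ∈ s, ‖c n‖ ^ 2 := by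
  set y := ∑ n ∈ s, c n • f n with hy
  have h1 : ‖y‖ ^ 2 ≤ ∑ n ∈ s, ‖c n‖ * ‖inner ℂ y (f n)‖ := by
    have h : (inner ℂ y y : ℂ) = ∑ n ∈ s, c n * inner ℂ y (f n) := by
      conv_lhs => rw [hy]
      rw [← hy, inner_sum]
      simp [inner_smul_right]
    calc ‖y‖ ^ 2 = ‖(inner ℂ y y : ℂ)‖ := by
          rw [inner_self_eq_norm_sq_to_K]; simp
      _ ≤ ∑ n ∈ s, ‖c n * inner ℂ y (f n)‖ := by rw [h]; exact norm_sum_le _ _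
      _ = _ := by simp
  have h2 := Finset.sum_mul_sq_le_sq_mul_sq s (fun n => ‖c n‖) (fun n => ‖inner ℂ y (f n)‖)
  have h3 : ∑ n ∈ s, ‖inner ℂ y (f n)‖ ^ 2 ≤ C * ‖y‖ ^ 2 :=
    ((hf y).1.sum_le_tsum s (fun _ _ => by positivity)).trans (hf y).2
  have h4 : 0 ≤ ∑ n ∈ s, ‖c n‖ ^ 2 := Finset.sum_nonneg fun _ _ => by positivity
  have h5 : (‖y‖ ^ 2) ^ 2 ≤ (∑ n ∈ s, ‖c n‖ ^ 2) * (C * ‖y‖ ^ 2) :=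
    (pow_le_pow_left₀ (by positivity) h1 2).trans (h2.trans (mul_le_mul_of_nonneg_left h3 h4))
  by_cases h0 : ‖y‖ ^ 2 = 0
  · rw [h0]; positivity
  · have : 0 < ‖y‖ ^ 2 := lt_of_le_of_ne (by positivity) (Ne.symm h0)
    nlinarith

theorem summable_smul_of_bessel {H : Type*} [NormedAddCommGroup H] [InnerProductSpace ℂ H]
    [CompleteSpace H] {f : ℕ → H} {C : ℝ} (hC : 0 ≤ C)
    (hf : ∀ x : H, Summable (fun n => ‖inner ℂ x (f n)‖ ^ 2) ∧
      ∑' n, ‖inner ℂ x (f n)‖ ^ 2 ≤ C * ‖x‖ ^ 2) (c : EllTwo) :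
    Summable (fun n => c n • f n) := by
  rw [summable_iff_vanishing_norm]
  intro ε hε
  have h := (summable_iff_vanishing_norm.1 (EllTwo.hasSum_sq c).summable)
    (ε ^ 2 / (C + 1)) (by positivity)
  obtain ⟨s, hs⟩ := h
  refine ⟨s, fun t ht => ?_⟩
  have h1 := norm_sum_smul_sq_le hC hf (fun n => c n) t
  have h4 : 0 ≤ ∑ n ∈ t, ‖c n‖ ^ 2 := Finset.sum_nonneg fun _ _ => by positivity
  have h2 := hs t ht
  rw [Real.norm_of_nonneg h4, lt_div_iff₀ (by positivity)] at h2
  refine lt_of_pow_lt_pow_left₀ 2 hε.le ?_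
  nlinarith

theorem IsFrame.exists_bessel {H : Type*} [NormedAddCommGroup H] [InnerProductSpace ℂ H]
    {f : ℕ → H} (hf : IsFrame f) :
    ∃ C : ℝ, 0 ≤ C ∧ ∀ x : H, Summable (fun n => ‖inner ℂ x (f n)‖ ^ 2) ∧
      ∑' n, ‖inner ℂ x (f n)‖ ^ 2 ≤ C * ‖x‖ ^ 2 := by
  obtain ⟨C₁, C₂, h1, h2, h⟩ := hf
  exact ⟨C₂, h1.le.trans h2, fun x => ⟨(h x).1, (h x).2.2⟩⟩

theorem IsFrame.summable_smul {H : Type*} [NormedAddCommGroup H] [InnerProductSpace ℂ H]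
    [CompleteSpace H] {f : ℕ → H} (hf : IsFrame f) (c : EllTwo) :
    Summable (fun n => c n • f n) := by
  obtain ⟨C, hC, h⟩ := hf.exists_bessel
  exact summable_smul_of_bessel hC h c

theorem IsFrame.exists_norm_le {H : Type*} [NormedAddCommGroup H] [InnerProductSpace ℂ H]
    [CompleteSpace H] {f : ℕ → H} (hf : IsFrame f) :
    ∃ K : ℝ, ∀ c : EllTwo, ‖∑' n, c n • f n‖ ≤ K * ‖c‖ := by
  obtain ⟨C, hC, h⟩ := hf.exists_bessel
  refine ⟨√C, fun c => ?_⟩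
  have h1 : ‖∑' n, c n • f n‖ ^ 2 ≤ C * ‖c‖ ^ 2 := by
    refine le_of_tendsto_of_tendsto ((hf.summable_smul c).hasSum.norm.pow 2)
      ((EllTwo.hasSum_sq c).const_mul C) (Eventually.of_forall fun s => ?_)
    exact norm_sum_smul_sq_le hC h (fun n => c n) s
  refine le_of_sq_le_sq ?_ (by positivity)
  rwa [mul_pow, Real.sq_sqrt hC]

/-- The synthesis operator `U c = ∑ c_n f_n` of a frame, as a bounded operator `ℓ²(ℕ) → H`. -/
def synthesisOperator {H : Type*} [NormedAddCommGroup H] [InnerProductSpace ℂ H]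
    [CompleteSpace H] (f : ℕ → H) (hf : IsFrame f) : EllTwo →L[ℂ] H :=
  LinearMap.mkContinuousOfExistsBound
    { toFun := fun c => ∑' n, c n • f n
      map_add' := fun c d => by
        simp only [lp.coeFn_add, Pi.add_apply, add_smul]
        exact (hf.summable_smul c).tsum_add (hf.summable_smul d)
      map_smul' := fun a c => by
        simp only [lp.coeFn_smul, Pi.smul_apply, smul_assoc, RingHom.id_apply]
        exact (hf.summable_smul c).tsum_const_smul a }
    hf.exists_norm_le

theorem synthesisOperator_hasSum {H : Type*} [NormedAddCommGroup H] [InnerProductSpace ℂ H]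
    [CompleteSpace H] {f : ℕ → H} (hf : IsFrame f) (c : EllTwo) :
    HasSum (fun n => c n • f n) (synthesisOperator f hf c) :=
  (hf.summable_smul c).hasSum

/-- The sequence `(0, x₀, x₁, x₂, …)`. -/
def shiftSeq (x : ℕ → ℂ) : ℕ → ℂ
  | 0 => 0
  | n + 1 => x n

theorem hasSum_shiftSeq_sq (c : EllTwo) :
    HasSum (fun n => ‖shiftSeq c n‖ ^ 2) (‖c‖ ^ 2) := by
  rw [← hasSum_nat_add_iff' 1]
  simpa [shiftSeq] using EllTwo.hasSum_sq c

theorem memℓp_shiftSeq (c : EllTwo) : Memℓp (shiftSeq c) 2 :=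
  memℓp_gen (by simpa using (hasSum_shiftSeq_sq c).summable)

/-- The right-shift operator `S (x₀, x₁, x₂, …) = (0, x₀, x₁, x₂, …)` on `ℓ²(ℕ)`. -/
def rightShift : EllTwo →L[ℂ] EllTwo :=
  LinearMap.mkContinuous
    { toFun := fun c => ⟨shiftSeq c, memℓp_shiftSeq c⟩
      map_add' := fun c d => by
        ext n
        change _ = shiftSeq c n + shiftSeq d n
        cases n <;> simp [shiftSeq]
      map_smul' := fun a c => by
        ext n; cases n <;> simp [shiftSeq] }
    1 (fun c => by
      rw [one_mul]
      refine le_of_sq_le_sq (le_of_eq ?_) (norm_nonneg _)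
      exact (EllTwo.hasSum_sq _).unique (hasSum_shiftSeq_sq c))

/-- The map `V`, sending `(c₀, c₁, …)` to the function `z ↦ ∑ c_n z^n`. Only its values on the
open unit disk are meaningful. -/
def hardyMap (c : EllTwo) : ℂ → ℂ := fun z => ∑' n, c n * z ^ n

/-- `g` restricted to the open unit disk belongs to the Hardy-Hilbert space: it is analytic there
and has a power series representation with square-summable coefficients. -/
def MemHardyTwo (g : ℂ → ℂ) : Prop :=
  AnalyticOnNhd ℂ g (Metric.ball 0 1) ∧
  ∃ a : ℕ → ℂ, Summable (fun n => ‖a n‖ ^ 2) ∧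
    ∀ z ∈ Metric.ball (0 : ℂ) 1, HasSum (fun n => a n * z ^ n) (g z)

theorem memHardyTwo_hardyMap (c : EllTwo) : MemHardyTwo (hardyMap c) := by
  have hb : ∀ n, ‖c n‖ ≤ ‖c‖ := fun n => lp.norm_apply_le_norm (by norm_num) c n
  have hs : ∀ z ∈ Metric.ball (0 : ℂ) 1, HasSum (fun n => c n * z ^ n) (hardyMap c z) := by
    intro z hz
    have hz' : ‖z‖ < 1 := by simpa using hz
    refine Summable.hasSum (Summable.of_norm_bounded
      ((summable_geometric_of_lt_one (norm_nonneg z) hz').mul_left ‖c‖) fun n => ?_)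
    rw [norm_mul, norm_pow]
    exact mul_le_mul_of_nonneg_right (hb n) (by positivity)
  refine ⟨?_, fun n => c n, (EllTwo.hasSum_sq c).summable, hs⟩
  have hp : HasFPowerSeriesOnBall (hardyMap c)
      (FormalMultilinearSeries.ofScalars ℂ (fun n => c n)) 0 1 := by
    refine ⟨?_, by norm_num, ?_⟩
    · refine FormalMultilinearSeries.le_radius_of_bound (r := 1) _ ‖c‖ fun n => ?_
      simpa [FormalMultilinearSeries.ofScalars_norm] using hb n
    · intro y hy
      have hy' : y ∈ Metric.ball (0 : ℂ) 1 := by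
        simpa [← ofReal_norm, ENNReal.ofReal_lt_one] using hy
      simpa [FormalMultilinearSeries.ofScalars_apply_eq, smul_eq_mul, mul_comm] using hs y hy'
  intro z hz
  refine hp.analyticAt_of_mem ?_
  simpa [← ofReal_norm, ENNReal.ofReal_lt_one] using hz

/-- An inner function: a function in the Hardy-Hilbert space whose radial limits exist and have
modulus one at almost every point `exp (iθ)` of the unit circle. -/
def IsInnerFunction (g : ℂ → ℂ) : Prop :=
  MemHardyTwo g ∧
  ∀ᵐ θ : ℝ ∂(volume.restrict (Ioc 0 (2 * Real.pi))), ∃ w : ℂ, ‖w‖ = 1 ∧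
    Tendsto (fun r : ℝ => g (r * Complex.exp (θ * Complex.I))) (𝓝[<] 1) (𝓝 w)

end

/-! ### Frames: the synthesis operator and a bounded right inverse -/

section Synthesis

variable {H : Type*} [NormedAddCommGroup H] [InnerProductSpace ℂ H] [CompleteSpace H] {f : ℕ → H}

/-! Write `U` for the synthesis operator, `S` for the right shift and `N` for the kernel of `U`. If
`T` moves each `f n` to `f (n + 1)`, then `U S = T U`, so `N` is `S`-invariant. Conversely, the
lower frame bound gives `U` a bounded right inverse `W`, and invariance of `N` makes `T = U S W`
satisfy `T U = U S`. Hence (i) says exactly that `N` is `S`-invariant. If `N = 0`, then `U` is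
bijective and `f` is a Riesz basis.

For `N ≠ 0` the claim is Beurling's theorem (`exists_eq_closure_span_rightShift_pow`). A unit vector
`c` in `N` orthogonal to `S N` has a boundary function on the circle whose squared modulus has the
Fourier coefficients of `1`, so it is unimodular. If `x ∈ N` is orthogonal to every `S^n c`, all
Fourier coefficients of `conj c * x` vanish, so `x = 0`.

That boundary function is defined in `L²`, whereas innerness concerns radial limits; Fatou's theorem
(`ae_tendsto_hardyMap_radial`) links them. The primitive of `∑ c_n z^n` is continuous on the closed
disk, and at almost every boundary point its derivative along the circle is governed by the `L²`
function. A Poisson kernel estimate turns differentiability along the circle into a radial limit of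
the derivative. -/

theorem synthesisOperator_single (hf : IsFrame f) (n : ℕ) :
    synthesisOperator f hf (lp.single 2 n 1) = f n := by
  refine (synthesisOperator_hasSum hf _).unique ?_
  convert hasSum_single n fun m hm => ?_ using 1
  · simp
  · simp [lp.single_apply, hm]

theorem adjoint_synthesisOperator_apply (hf : IsFrame f) (x : H) (n : ℕ) :
    ContinuousLinearMap.adjoint (synthesisOperator f hf) x n = inner ℂ (f n) x := by
  rw [← synthesisOperator_single hf n, ← ContinuousLinearMap.adjoint_inner_right,
    lp.inner_single_left]
  simp

/-- The lower frame bound says `⟨U U* x, x⟩ ≥ C₁ ‖x‖²`, so `U U*` is invertible and `U* (U U*)⁻¹` is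
a right inverse. -/
theorem exists_synthesisOperator_rightInverse (hf : IsFrame f) :
    ∃ W : H →L[ℂ] EllTwo, ∀ x, synthesisOperator f hf (W x) = x := by
  set U := synthesisOperator f hf with hU
  have hf' := hf
  obtain ⟨C₁, C₂, hC₁, -, h⟩ := hf'
  have key : IsUnit (U ∘L ContinuousLinearMap.adjoint U) := by
    refine ContinuousLinearMap.isUnit_of_forall_le_norm_inner_map _ (c := C₁.toNNReal)
      (Real.toNNReal_pos.2 hC₁) fun x => ?_
    rw [Real.coe_toNNReal _ hC₁.le, ContinuousLinearMap.comp_apply, ← ContinuousLinearMap.adjoint_inner_right,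
      inner_self_eq_norm_sq_to_K, norm_pow, RCLike.norm_ofReal, abs_norm,
      ← (EllTwo.hasSum_sq _).tsum_eq]
    have h1 := (h x).2.1
    simp only [hU, adjoint_synthesisOperator_apply]
    simp only [fun n => norm_inner_symm (𝕜 := ℂ) x (f n)] at h1
    rw [mul_comm]
    exact h1
  obtain ⟨u, hu⟩ := key
  refine ⟨ContinuousLinearMap.adjoint U ∘L (↑u⁻¹ : H →L[ℂ] H), fun x => ?_⟩
  have := congrArg (fun T : H →L[ℂ] H => T x) u.mul_inv
  simpa [hu] using this

theorem synthesisOperator_surjective (hf : IsFrame f) :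
    Function.Surjective (synthesisOperator f hf) := by
  obtain ⟨W, hW⟩ := exists_synthesisOperator_rightInverse hf
  exact fun x => ⟨W x, hW x⟩

end Synthesis

/-! ### The right shift and wandering vectors -/

section Shift

@[simp]
theorem rightShift_apply_zero (c : EllTwo) : rightShift c 0 = 0 := rfl

@[simp]
theorem rightShift_apply_succ (c : EllTwo) (n : ℕ) : rightShift c (n + 1) = c n := rfl

theorem norm_rightShift (c : EllTwo) : ‖rightShift c‖ = ‖c‖ := by
  have : ‖rightShift c‖ ^ 2 = ‖c‖ ^ 2 := (EllTwo.hasSum_sq _).unique (hasSum_shiftSeq_sq c)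
  exact (sq_eq_sq₀ (norm_nonneg _) (norm_nonneg _)).1 this

/-- The right shift as a linear isometry. -/
noncomputable def rightShiftIsometry : EllTwo →ₗᵢ[ℂ] EllTwo where
  toLinearMap := rightShift
  norm_map' := norm_rightShift

theorem rightShift_single (n : ℕ) :
    rightShift (lp.single 2 n 1) = lp.single 2 (n + 1) 1 := by
  ext m
  cases m <;> simp [lp.single_apply, Pi.single_apply]

theorem rightShift_pow_apply_add (c : EllTwo) (k n : ℕ) : (rightShift ^ k) c (n + k) = c n := by
  induction k with
  | zero => simp
  | succ k ih => rw [pow_succ', mul_apply_eq_comp, ← add_assoc, rightShift_apply_succ, ih]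

theorem rightShift_pow_apply_of_lt (c : EllTwo) {k n : ℕ} (h : n < k) :
    (rightShift ^ k) c n = 0 := by
  induction k generalizing n with
  | zero => omega
  | succ k ih =>
    rw [pow_succ', mul_apply_eq_comp]
    cases n with
    | zero => simp
    | succ n => rw [rightShift_apply_succ, ih (by omega)]

/-- A nonzero closed shift-invariant subspace contains a unit vector orthogonal to its shift. -/
theorem exists_wandering_unit {N : Submodule ℂ EllTwo} (hN : IsClosed (N : Set EllTwo))
    (hS : ∀ x ∈ N, rightShift x ∈ N) (h0 : N ≠ ⊥) :
    ∃ c ∈ N, ‖c‖ = 1 ∧ ∀ y ∈ N, (inner ℂ (rightShift y) c : ℂ) = 0 := by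
  by_contra! hcon
  have h1 : ∀ c ∈ N, (∀ y ∈ N, (inner ℂ (rightShift y) c : ℂ) = 0) → c = 0 := by
    intro c hc h
    by_contra hc0
    obtain ⟨y, hy, hne⟩ := hcon ((‖c‖⁻¹ : ℂ) • c) (N.smul_mem _ hc)
      (by rw [norm_smul]; simp [hc0])
    exact hne (by rw [inner_smul_right, h y hy, mul_zero])
  -- If no such vector existed, the complement of `S N` in `N` would be trivial. As `S` is
  -- isometric, `S N` is closed, so projecting onto it gives `N = S N`; iterating, every coordinate
  -- of every element of `N` vanishes.
  set M := N.map rightShiftIsometry.toLinearMap with hM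
  have hMc : IsClosed (M : Set EllTwo) := by
    rw [hM, Submodule.map_coe]
    exact (rightShiftIsometry.isometry.isClosedEmbedding).isClosedMap _ hN
  have : CompleteSpace M := hMc.completeSpace_coe
  have h2 : ∀ x ∈ N, ∃ y ∈ N, rightShift y = x := by
    intro x hx
    have hp : M.starProjection x ∈ M := Submodule.starProjection_apply_mem _ _
    obtain ⟨y, hy, hyx⟩ := hp
    have hz : x - M.starProjection x = 0 := by
      refine h1 _ (N.sub_mem hx ?_) fun z hz => ?_
      · rw [← hyx]; exact hS y hy
      · exact Submodule.sub_starProjection_mem_orthogonal x _ ⟨z, hz, rfl⟩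
    exact ⟨y, hy, hyx.trans (sub_eq_zero.1 hz).symm⟩
  refine h0 ((Submodule.eq_bot_iff _).2 fun x hx => ?_)
  have h3 : ∀ n, ∀ x ∈ N, x n = 0 := by
    intro n
    induction n with
    | zero =>
      intro x hx
      obtain ⟨y, -, rfl⟩ := h2 x hx
      simp
    | succ n ih =>
      intro x hx
      obtain ⟨y, hy, rfl⟩ := h2 x hx
      simpa using ih y hy
  ext n
  simpa using h3 n x hx

theorem rightShift_mem_closure_span (c : EllTwo) {x : EllTwo}
    (hx : x ∈ (Submodule.span ℂ (range fun n : ℕ => (rightShift ^ n) c)).topologicalClosure) :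
    rightShift x ∈
      (Submodule.span ℂ (range fun n : ℕ => (rightShift ^ n) c)).topologicalClosure := by
  have hmaps : MapsTo rightShift
      (Submodule.span ℂ (range fun n : ℕ => (rightShift ^ n) c) : Set EllTwo)
      (Submodule.span ℂ (range fun n : ℕ => (rightShift ^ n) c)) := by
    intro y hy
    have : (Submodule.span ℂ (range fun n : ℕ => (rightShift ^ n) c)) ≤
        (Submodule.span ℂ (range fun n : ℕ => (rightShift ^ n) c)).comap rightShift.toLinearMap := by
      rw [Submodule.span_le]
      rintro _ ⟨n, rfl⟩
      refine Submodule.subset_span ⟨n + 1, ?_⟩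
      simp only [pow_succ']
      rfl
    exact this hy
  exact map_mem_closure rightShift.continuous hx hmaps

end Shift

/-! ### Orbits, shift-invariant kernels and Riesz bases -/

section Dynamics

variable {H : Type*} [NormedAddCommGroup H] [InnerProductSpace ℂ H] [CompleteSpace H] {f : ℕ → H}

/-- A frame is an orbit of a bounded operator as soon as the kernel of its synthesis operator is
shift-invariant. -/
theorem exists_orbit_of_ker_invariant (hf : IsFrame f)
    (h : ∀ x ∈ (synthesisOperator f hf).ker, rightShift x ∈ (synthesisOperator f hf).ker) :
    ∃ T : H →L[ℂ] H, ∀ n : ℕ, f n = (T ^ n) (f 0) := by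
  obtain ⟨W, hW⟩ := exists_synthesisOperator_rightInverse hf
  set U := synthesisOperator f hf with hU
  set T := U ∘L rightShift ∘L W with hT
  have hTU : ∀ x, T (U x) = U (rightShift x) := by
    intro x
    -- `W U x` and `x` differ by a kernel element, and invariance keeps that difference in the
    -- kernel after shifting.
    have h1 : W (U x) - x ∈ U.ker := by
      change U _ = 0
      rw [map_sub, hW, sub_self]
    have h2 : U (rightShift (W (U x) - x)) = 0 := h _ h1
    rw [map_sub, map_sub, sub_eq_zero] at h2
    exact h2
  refine ⟨T, fun n => ?_⟩
  induction n with
  | zero => simp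
  | succ n ih =>
    rw [pow_succ', mul_apply_eq_comp, ← ih, ← synthesisOperator_single hf n, hTU,
      rightShift_single, hU, synthesisOperator_single]

theorem synthesisOperator_rightShift (hf : IsFrame f) {T : H →L[ℂ] H}
    (hT : ∀ n : ℕ, f n = (T ^ n) (f 0)) (c : EllTwo) :
    synthesisOperator f hf (rightShift c) = T (synthesisOperator f hf c) := by
  have h1 := (synthesisOperator_hasSum hf c).mapL T
  have h2 : ∀ n, T (f n) = f (n + 1) := by
    intro n
    rw [hT (n + 1), pow_succ', mul_apply_eq_comp, ← hT n]
  refine (synthesisOperator_hasSum hf (rightShift c)).unique ?_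
  rw [← hasSum_nat_add_iff' 1]
  simpa [h2] using h1

/-- A frame with injective synthesis operator is a Riesz basis. -/
theorem isRieszBasis_of_ker_eq_bot (hf : IsFrame f) (hli : LinearIndependent ℂ f)
    (h : (synthesisOperator f hf).ker = ⊥) : IsRieszBasis f := by
  -- Gram–Schmidt applied to `f` supplies an orthonormal basis indexed by `ℕ`; its span is dense
  -- because every vector is a limit of finite combinations of the `f n`.
  have hspan : ⊤ ≤ (Submodule.span ℂ
      (range (InnerProductSpace.gramSchmidtNormed ℂ f))).topologicalClosure := by
    rw [InnerProductSpace.span_gramSchmidtNormed_range, InnerProductSpace.span_gramSchmidt]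
    intro x _
    obtain ⟨c, rfl⟩ := synthesisOperator_surjective hf x
    refine mem_closure_of_tendsto (synthesisOperator_hasSum hf c) (Eventually.of_forall fun s => ?_)
    exact Submodule.sum_mem _ fun n _ => Submodule.smul_mem _ _ (Submodule.subset_span ⟨n, rfl⟩)
  set e : HilbertBasis ℕ ℂ H :=
    HilbertBasis.mk (InnerProductSpace.gramSchmidtNormed_orthonormal hli) hspan
  refine ⟨e, synthesisOperator f hf ∘L (e.repr : H →L[ℂ] EllTwo), ?_, fun n => ?_⟩
  · have hU : Function.Bijective (synthesisOperator f hf) :=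
      ⟨LinearMap.ker_eq_bot.1 h, synthesisOperator_surjective hf⟩
    exact hU.comp e.repr.bijective
  · simp only [ContinuousLinearMap.comp_apply]
    have : e.repr (e n) = lp.single 2 n 1 := e.repr_self n
    exact (synthesisOperator_single hf n).symm.trans (congrArg _ this.symm)

theorem IsRieszBasis.ker_synthesisOperator (hf : IsFrame f) (h : IsRieszBasis f) :
    (synthesisOperator f hf).ker = ⊥ := by
  obtain ⟨e, A, hA, hfe⟩ := h
  rw [Submodule.eq_bot_iff]
  intro c hc
  have h1 : HasSum (fun n => c n • f n) (A (e.repr.symm c)) := by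
    simpa [hfe] using (e.hasSum_repr_symm c).mapL A
  have h2 : A (e.repr.symm c) = 0 := (h1.unique (synthesisOperator_hasSum hf c)).trans hc
  have h3 : e.repr.symm c = 0 := hA.1 (h2.trans (map_zero A).symm)
  simpa using h3

end Dynamics

/-! ### Uniqueness of Fourier coefficients for integrable functions -/

section FourierUniqueness

variable {T : ℝ} [hT : Fact (0 < T)]

open AddCircle in
/-- An integrable function on the circle all of whose Fourier coefficients vanish is zero
almost everywhere. -/
theorem ae_eq_zero_of_fourierCoeff_eq_zero {h : AddCircle T → ℂ} (hh : Integrable h haarAddCircle)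
    (h0 : ∀ n, fourierCoeff h n = 0) : h =ᵐ[haarAddCircle] 0 := by
  have hbd : ∀ g : C(AddCircle T, ℂ), Integrable (fun x => g x * h x) haarAddCircle := fun g =>
    hh.bdd_mul g.continuous.aestronglyMeasurable (Eventually.of_forall g.norm_coe_le_norm)
  have h1 : ∀ g : C(AddCircle T, ℂ), ∫ x, g x * h x ∂haarAddCircle = 0 := by
    let Φ : C(AddCircle T, ℂ) →ₗ[ℂ] ℂ :=
      { toFun := fun g => ∫ x, g x * h x ∂haarAddCircle
        map_add' := fun f g => by
          simp only [ContinuousMap.add_apply, add_mul]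
          exact integral_add (hbd f) (hbd g)
        map_smul' := fun a g => by
          simp only [ContinuousMap.smul_apply, smul_eq_mul, mul_assoc, RingHom.id_apply]
          exact integral_const_mul _ _ }
    let Ψ : C(AddCircle T, ℂ) →L[ℂ] ℂ := Φ.mkContinuous (∫ x, ‖h x‖ ∂haarAddCircle) fun g => by
      change ‖∫ x, g x * h x ∂haarAddCircle‖ ≤ _
      rw [mul_comm, ← integral_const_mul]
      refine norm_integral_le_of_norm_le (hh.norm.const_mul _) (Eventually.of_forall fun x => ?_)
      rw [norm_mul]
      exact mul_le_mul_of_nonneg_right (g.norm_coe_le_norm x) (norm_nonneg _)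
    -- Pairing with `h` is continuous in the uniform norm and kills the trigonometric polynomials,
    -- which are dense.
    have hle : (Submodule.span ℂ (range (@fourier T))).topologicalClosure ≤ Ψ.ker := by
      refine Submodule.topologicalClosure_minimal _ ?_ Ψ.isClosed_ker
      rw [Submodule.span_le]
      rintro _ ⟨n, rfl⟩
      have := h0 (-n)
      rw [fourierCoeff, neg_neg] at this
      exact this
    intro g
    rw [span_fourier_closure_eq_top] at hle
    exact hle (Submodule.mem_top (x := g))
  -- Indicators of closed sets are bounded pointwise limits of continuous functions, so dominated
  -- convergence applies.
  refine ae_eq_zero_of_forall_setIntegral_isClosed_eq_zero hh fun K hK => ?_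
  have hδ : ∀ n : ℕ, (0 : ℝ) < 1 / (n + 1) := fun n => by positivity
  have hlim : Tendsto (fun n : ℕ => ∫ x, ((thickenedIndicator (hδ n) K x : ℝ) : ℂ) * h x
      ∂haarAddCircle) atTop (𝓝 (∫ x, K.indicator h x ∂haarAddCircle)) := by
    refine tendsto_integral_of_dominated_convergence (fun x => ‖h x‖) (fun n => ?_) hh.norm
      (fun n => Eventually.of_forall fun x => ?_) (Eventually.of_forall fun x => ?_)
    · refine AEStronglyMeasurable.mul (Continuous.aestronglyMeasurable ?_) hh.1
      have := (thickenedIndicator (hδ n) K).continuous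
      fun_prop
    · rw [norm_mul, Complex.norm_real]
      refine mul_le_of_le_one_left (norm_nonneg _) ?_
      rw [NNReal.norm_eq]
      exact_mod_cast thickenedIndicator_le_one (hδ n) K x
    · have := (tendsto_pi_nhds.1 (thickenedIndicator_tendsto_indicator_closure hδ
        tendsto_one_div_add_atTop_nhds_zero_nat K)) x
      rw [hK.closure_eq] at this
      have h2 : Tendsto (fun n : ℕ => ((thickenedIndicator (hδ n) K x : ℝ) : ℂ) * h x) atTop
          (𝓝 (((K.indicator (fun _ => (1 : NNReal)) x : NNReal) : ℂ) * h x)) :=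
        (((Complex.continuous_ofReal.comp NNReal.continuous_coe).tendsto _).comp this).mul_const _
      convert h2 using 2
      by_cases hx : x ∈ K <;> simp [hx]
  rw [← integral_indicator hK.measurableSet]
  refine tendsto_nhds_unique hlim ?_
  have h3 : ∀ n : ℕ, ∫ x, ((thickenedIndicator (hδ n) K x : ℝ) : ℂ) * h x ∂haarAddCircle = 0 :=
    fun n => h1 ⟨fun x => ((thickenedIndicator (hδ n) K x : ℝ) : ℂ), by
      have := (thickenedIndicator (hδ n) K).continuous
      fun_prop⟩
  simp only [h3]
  exact tendsto_const_nhds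

open AddCircle in
/-- Integrable functions on the circle with the same Fourier coefficients agree almost
everywhere. -/
theorem ae_eq_of_fourierCoeff_eq {g h : AddCircle T → ℂ} (hg : Integrable g haarAddCircle)
    (hh : Integrable h haarAddCircle) (h0 : ∀ n, fourierCoeff g n = fourierCoeff h n) :
    g =ᵐ[haarAddCircle] h := by
  have key := ae_eq_zero_of_fourierCoeff_eq_zero (hg.sub hh) fun n => by
    have := h0 n
    simp only [fourierCoeff, Pi.sub_apply, smul_sub] at this ⊢
    rw [integral_sub (hg.fourier_smul _) (hh.fourier_smul _), this, sub_self]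
  filter_upwards [key] with x hx
  exact sub_eq_zero.1 hx

end FourierUniqueness

/-! ### Boundary functions in `L²` of the circle and Beurling's theorem -/

section BoundaryFunction

open AddCircle

variable {T : ℝ} [hT : Fact (0 < T)]

variable (T) in
theorem orthogonalFamily_fourierLp_natCast :
    OrthogonalFamily ℂ (fun _ : ℕ => ℂ) fun n : ℕ =>
      LinearIsometry.toSpanSingleton ℂ (Lp ℂ 2 (@haarAddCircle T hT))
        ((orthonormal_fourier (T := T)).1 (n : ℤ)) :=
  ((orthonormal_fourier (T := T)).comp _ Nat.cast_injective).orthogonalFamily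

variable (T) in
/-- The isometry sending `(c₀, c₁, …)` to the square-integrable function `∑ cₙ e^{2πinx/T}` on the
circle. -/
noncomputable def hardyBoundary : EllTwo →ₗᵢ[ℂ] Lp ℂ 2 (@haarAddCircle T hT) :=
  (orthogonalFamily_fourierLp_natCast T).linearIsometry

theorem hasSum_hardyBoundary (c : EllTwo) :
    HasSum (fun n : ℕ => c n • fourierLp (T := T) 2 (n : ℤ)) (hardyBoundary T c) :=
  (orthogonalFamily_fourierLp_natCast T).hasSum_linearIsometry c

theorem integrable_lp_two (g : Lp ℂ 2 (@haarAddCircle T hT)) : Integrable g haarAddCircle :=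
  (Lp.memLp g).integrable (by norm_num)

theorem fourierCoeff_fourier_mul (g : AddCircle T → ℂ) (k n : ℤ) :
    fourierCoeff (fun x => fourier k x * g x) n = fourierCoeff g (n - k) := by
  simp only [fourierCoeff, smul_eq_mul]
  refine integral_congr_ae (Eventually.of_forall fun x => ?_)
  simp only
  rw [← mul_assoc, ← fourier_add]
  congr 3
  ring

theorem hasSum_fourierCoeff_hardyBoundary (c : EllTwo) (n : ℤ) :
    HasSum (fun m : ℕ => if n = m then c m else 0) (fourierCoeff (hardyBoundary T c) n) := by
  have h := (hasSum_hardyBoundary (T := T) c).mapL (innerSL ℂ (fourierLp (T := T) 2 n))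
  rw [← fourierBasis_repr, HilbertBasis.repr_apply_apply, coe_fourierBasis]
  simpa [inner_smul_right, orthonormal_iff_ite.1 (orthonormal_fourier (T := T))] using h

theorem fourierCoeff_hardyBoundary_natCast (c : EllTwo) (n : ℕ) :
    fourierCoeff (hardyBoundary T c) n = c n := by
  refine (hasSum_fourierCoeff_hardyBoundary c n).unique ?_
  convert hasSum_ite_eq n (c n) using 2 with m
  aesop

theorem fourierCoeff_hardyBoundary_of_neg (c : EllTwo) {n : ℤ} (hn : n < 0) :
    fourierCoeff (hardyBoundary T c) n = 0 := by
  refine (hasSum_fourierCoeff_hardyBoundary c n).unique ?_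
  convert hasSum_zero using 2 with m
  exact if_neg (by omega)

theorem hardyBoundary_rightShift_pow (c : EllTwo) (k : ℕ) :
    hardyBoundary T ((rightShift ^ k) c) =ᵐ[haarAddCircle]
      fun x => fourier (k : ℤ) x * hardyBoundary T c x := by
  refine ae_eq_of_fourierCoeff_eq (integrable_lp_two _)
    ((integrable_lp_two (hardyBoundary T c)).fourier_smul k) fun n => ?_
  rw [fourierCoeff_fourier_mul]
  rcases lt_or_ge n 0 with hn | hn
  · rw [fourierCoeff_hardyBoundary_of_neg _ hn, fourierCoeff_hardyBoundary_of_neg _ (by omega)]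
  lift n to ℕ using hn
  rw [fourierCoeff_hardyBoundary_natCast]
  rcases lt_or_ge n k with hnk | hnk
  · rw [fourierCoeff_hardyBoundary_of_neg _ (by omega), rightShift_pow_apply_of_lt _ hnk]
  · obtain ⟨m, rfl⟩ := Nat.exists_eq_add_of_le' hnk
    rw [rightShift_pow_apply_add, Nat.cast_add, add_sub_cancel_right,
      fourierCoeff_hardyBoundary_natCast]

theorem integral_conj_mul_hardyBoundary (c d : EllTwo) :
    ∫ x, starRingEnd ℂ (hardyBoundary T c x) * hardyBoundary T d x ∂haarAddCircle =
      inner ℂ c d := by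
  rw [← (hardyBoundary T).inner_map_map, L2.inner_def]
  simp only [RCLike.inner_apply, mul_comm]

/-- Shifting is multiplication by a character on the circle, so orthogonality relations between
shifts become statements about the Fourier coefficients of one integrable function. -/
theorem fourierCoeff_conj_mul_hardyBoundary_natCast (c d : EllTwo) (k : ℕ) :
    fourierCoeff (fun x => starRingEnd ℂ (hardyBoundary T c x) * hardyBoundary T d x) k =
      inner ℂ ((rightShift ^ k) c) d := by
  rw [← integral_conj_mul_hardyBoundary (T := T), fourierCoeff]
  refine integral_congr_ae ?_
  filter_upwards [hardyBoundary_rightShift_pow (T := T) c k] with x hx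
  rw [hx, fourier_neg, map_mul, smul_eq_mul, mul_assoc]

theorem fourierCoeff_conj_mul_hardyBoundary_neg_natCast (c d : EllTwo) (k : ℕ) :
    fourierCoeff (fun x => starRingEnd ℂ (hardyBoundary T c x) * hardyBoundary T d x) (-k) =
      inner ℂ c ((rightShift ^ k) d) := by
  rw [← integral_conj_mul_hardyBoundary (T := T), fourierCoeff]
  refine integral_congr_ae ?_
  filter_upwards [hardyBoundary_rightShift_pow (T := T) d k] with x hx
  rw [hx, neg_neg, smul_eq_mul, mul_left_comm]

theorem integrable_conj_mul_hardyBoundary (c d : EllTwo) :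
    Integrable (fun x => starRingEnd ℂ (hardyBoundary T c x) * hardyBoundary T d x)
      haarAddCircle := by
  refine (L2.integrable_inner (𝕜 := ℂ) (hardyBoundary T c) (hardyBoundary T d)).congr
    (Eventually.of_forall fun x => ?_)
  simp only [RCLike.inner_apply, mul_comm]

/-- A unit vector orthogonal to its proper shifts has a unimodular boundary function. -/
theorem norm_hardyBoundary_eq_one {c : EllTwo} (hc : ‖c‖ = 1)
    (h : ∀ k : ℕ, (inner ℂ ((rightShift ^ (k + 1)) c) c : ℂ) = 0) :
    ∀ᵐ x ∂(@haarAddCircle T hT), ‖hardyBoundary T c x‖ = 1 := by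
  have h1 : ∀ n, fourierCoeff
      (fun x => starRingEnd ℂ (hardyBoundary T c x) * hardyBoundary T c x) n =
      fourierCoeff (fun _ : AddCircle T => (1 : ℂ)) n := by
    intro n
    have hone : fourierCoeff (fun _ : AddCircle T => (1 : ℂ)) n = if n = 0 then 1 else 0 := by
      have h1 : ((fourier 0 : C(AddCircle T, ℂ)) : AddCircle T → ℂ) = fun _ => 1 :=
        funext fun x => fourier_zero
      rw [← h1, fourierCoeff_fourier, Pi.single_apply]
    rw [hone]
    rcases n with (_ | k) | k
    · have := fourierCoeff_conj_mul_hardyBoundary_natCast (T := T) c c 0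
      simpa [hc] using this
    · have := fourierCoeff_conj_mul_hardyBoundary_natCast (T := T) c c (k + 1)
      rw [h] at this
      rw [if_neg (by simp; omega)]
      exact this
    -- The remaining index is `-(k + 1)`; it reduces to the positive case by conjugate symmetry.
    · have := fourierCoeff_conj_mul_hardyBoundary_neg_natCast (T := T) c c (k + 1)
      rw [← inner_conj_symm, h, map_zero] at this
      rw [if_neg (by simp)]
      exact this
  filter_upwards [ae_eq_of_fourierCoeff_eq (integrable_conj_mul_hardyBoundary c c)
    (integrable_const 1) h1] with x hx
  rw [Complex.conj_mul'] at hx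
  have : ‖hardyBoundary T c x‖ ^ 2 = 1 := by exact_mod_cast hx
  exact (pow_eq_one_iff_of_nonneg (norm_nonneg _) two_ne_zero).1 this

/-- If the boundary function of `c` vanishes almost nowhere, a vector `x` such that `x` is
orthogonal to all shifts of `c` and `c` to all proper shifts of `x` is zero. -/
theorem eq_zero_of_inner_rightShift_pow_eq_zero {c x : EllTwo}
    (hc : ∀ᵐ t ∂(@haarAddCircle T hT), hardyBoundary T c t ≠ 0)
    (h : ∀ k : ℕ, (inner ℂ ((rightShift ^ k) c) x : ℂ) = 0)
    (h' : ∀ k : ℕ, (inner ℂ ((rightShift ^ (k + 1)) x) c : ℂ) = 0) : x = 0 := by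
  have h1 : ∀ n, fourierCoeff
      (fun t => starRingEnd ℂ (hardyBoundary T c t) * hardyBoundary T x t) n = 0 := by
    intro n
    rcases n with k | k
    · exact (fourierCoeff_conj_mul_hardyBoundary_natCast c x k).trans (h k)
    · have := fourierCoeff_conj_mul_hardyBoundary_neg_natCast (T := T) c x (k + 1)
      rw [← inner_conj_symm, h', map_zero] at this
      exact this
  have h2 : hardyBoundary T x = 0 := by
    rw [Lp.eq_zero_iff_ae_eq_zero]
    filter_upwards [hc, ae_eq_zero_of_fourierCoeff_eq_zero
      (integrable_conj_mul_hardyBoundary c x) h1] with t ht ht'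
    exact (mul_eq_zero.1 ht').resolve_left (by simpa using ht)
  exact (map_eq_zero_iff _ (hardyBoundary T).injective).1 h2

/-- **Beurling's theorem**: a nonzero closed shift-invariant subspace of `ℓ²(ℕ)` is generated by a
single vector with unimodular boundary function. -/
theorem exists_eq_closure_span_rightShift_pow {N : Submodule ℂ EllTwo}
    (hN : IsClosed (N : Set EllTwo)) (hS : ∀ x ∈ N, rightShift x ∈ N) (h0 : N ≠ ⊥) :
    ∃ c : EllTwo, (∀ᵐ x ∂(@haarAddCircle T hT), ‖hardyBoundary T c x‖ = 1) ∧
      N = (Submodule.span ℂ (range fun n : ℕ => (rightShift ^ n) c)).topologicalClosure := by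
  obtain ⟨c, hcN, hc1, hc⟩ := exists_wandering_unit hN hS h0
  have hSk : ∀ k : ℕ, ∀ x ∈ N, (rightShift ^ k) x ∈ N := by
    intro k
    induction k with
    | zero => simp
    | succ k ih =>
      intro x hx
      rw [pow_succ', mul_apply_eq_comp]
      exact hS _ (ih x hx)
  have hck : ∀ x ∈ N, ∀ k : ℕ, (inner ℂ ((rightShift ^ (k + 1)) x) c : ℂ) = 0 := by
    intro x hx k
    rw [pow_succ', mul_apply_eq_comp]
    exact hc _ (hSk k x hx)
  have hunit := norm_hardyBoundary_eq_one (T := T) hc1 (hck c hcN)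
  refine ⟨c, hunit, ?_⟩
  set M := (Submodule.span ℂ (range fun n : ℕ => (rightShift ^ n) c)).topologicalClosure with hM
  have hMN : M ≤ N := by
    refine Submodule.topologicalClosure_minimal _ ?_ hN
    rw [Submodule.span_le]
    rintro _ ⟨n, rfl⟩
    exact hSk n c hcN
  have : CompleteSpace M := (Submodule.isClosed_topologicalClosure _).completeSpace_coe
  refine le_antisymm (fun x hx => ?_) hMN
  have hp : M.starProjection x ∈ M := Submodule.starProjection_apply_mem _ _
  -- The residual is orthogonal to every `S^k c`; being in `N`, it also has its proper shifts
  -- orthogonal to `c`.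
  have hz : x - M.starProjection x = 0 := by
    refine eq_zero_of_inner_rightShift_pow_eq_zero (T := T) (c := c) ?_ (fun k => ?_)
      (hck _ (N.sub_mem hx (hMN hp)))
    · filter_upwards [hunit] with t ht h
      simp [h] at ht
    · exact Submodule.sub_starProjection_mem_orthogonal x _
        (Submodule.le_topologicalClosure _ (Submodule.subset_span ⟨k, rfl⟩))
  rw [sub_eq_zero.1 hz]
  exact hp

end BoundaryFunction

/-! ### Radial limits of derivatives via reflected Cauchy kernels -/

/-- The Cauchy integral formula for the first derivative, for a function that is continuous up to
the boundary. -/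
theorem DiffContOnCl.circleIntegral_sub_zpow_neg_two_mul {F : ℂ → ℂ} {c w : ℂ} {R : ℝ}
    (hF : DiffContOnCl ℂ F (Metric.ball c R)) (hw : w ∈ Metric.ball c R) :
    (∮ z in C(c, R), (z - w) ^ (-2 : ℤ) * F z) = 2 * Real.pi * Complex.I * deriv F w := by
  have hR : 0 < R := Metric.pos_of_mem_ball hw
  have hne : ∀ z ∈ Metric.sphere c R, z - w ≠ 0 := fun z hz h => by
    rw [sub_eq_zero.1 h] at hz
    exact (Metric.mem_ball.1 hw).ne (Metric.mem_sphere.1 hz)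
  have hcl : closure (Metric.ball c R) = Metric.closedBall c R := closure_ball c hR.ne'
  have hcont : ContinuousOn F (Metric.closedBall c R) := hcl ▸ hF.continuousOn
  -- The difference quotient takes the value `deriv F w` at `w`, so the ordinary Cauchy formula
  -- applies to it; the leftover constant `F w` integrates to zero against `(z - w)⁻²`.
  have hd : DiffContOnCl ℂ (dslope F w) (Metric.ball c R) := by
    refine ⟨(Complex.differentiableOn_dslope (Metric.isOpen_ball.mem_nhds hw)).2 hF.1, ?_⟩
    rw [hcl]
    exact (continuousOn_dslope (Metric.closedBall_mem_nhds_of_mem hw)).2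
      ⟨hcont, hF.differentiableAt Metric.isOpen_ball hw⟩
  have h1 := hd.circleIntegral_sub_inv_smul hw
  rw [dslope_same, smul_eq_mul] at h1
  have hcz : ContinuousOn (fun z => (z - w) ^ (-2 : ℤ)) (Metric.sphere c R) :=
    ContinuousOn.zpow₀ (by fun_prop) _ fun z hz => Or.inl (hne z hz)
  have hi1 : CircleIntegrable (fun z => (z - w) ^ (-2 : ℤ) * F z) c R :=
    (hcz.mul (hcont.mono Metric.sphere_subset_closedBall)).circleIntegrable hR.le
  have hi2 : CircleIntegrable (fun z => (z - w) ^ (-2 : ℤ) * F w) c R :=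
    (hcz.mul continuousOn_const).circleIntegrable hR.le
  have h2 : (∮ z in C(c, R), (z - w)⁻¹ • dslope F w z) =
      ∮ z in C(c, R), ((z - w) ^ (-2 : ℤ) * F z - (z - w) ^ (-2 : ℤ) * F w) := by
    refine circleIntegral.integral_congr hR.le fun z hz => ?_
    have hz' := hne z hz
    simp only [smul_eq_mul]
    rw [dslope_of_ne _ (sub_ne_zero.1 hz'), slope_def_field,
      show (-2 : ℤ) = -(2 : ℕ) by rfl, zpow_neg, zpow_natCast]
    field_simp
  have h3 : (∮ z in C(c, R), (z - w) ^ (-2 : ℤ) * F w) = 0 := by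
    have := circleIntegral.integral_smul_const (fun z => (z - w) ^ (-2 : ℤ)) (F w) c R
    simp only [smul_eq_mul] at this
    rw [this, circleIntegral.integral_sub_zpow_of_ne (by decide), zero_mul]
  rw [← h1, h2, circleIntegral.integral_sub hi1 hi2, h3, sub_zero]

/-- `ζ₀ / r` is the reflection of `r ζ₀` in the unit circle, and on the circle the two distances
have constant ratio. -/
theorem norm_sub_inv_smul_of_mem_sphere {ζ ζ₀ : ℂ} (hζ : ‖ζ‖ = 1) (hζ₀ : ‖ζ₀‖ = 1) {r : ℝ}
    (hr : 0 < r) : ‖ζ - ζ₀ / r‖ = ‖ζ - r * ζ₀‖ / r := by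
  have hr' : (r : ℂ) ≠ 0 := by exact_mod_cast hr.ne'
  have h1 : ζ - ζ₀ / r = (r * ζ - ζ₀) / r := by field_simp
  have h2 : ‖(r : ℂ) * ζ - ζ₀‖ = ‖ζ - r * ζ₀‖ := by
    refine (sq_eq_sq₀ (norm_nonneg _) (norm_nonneg _)).1 ?_
    rw [@norm_sub_sq_real ℂ, @norm_sub_sq_real ℂ, norm_mul, norm_mul, hζ, hζ₀]
    simp [mul_comm, mul_left_comm, mul_assoc]
    ring
  rw [h1, norm_div, h2, Complex.norm_real, Real.norm_of_nonneg hr.le]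

/-- The difference of the Cauchy kernels for the derivative at a point and at its reflection is
controlled by the Poisson kernel. -/
theorem norm_cauchyKernel_sub_reflected_le {ζ ζ₀ : ℂ} (hζ : ‖ζ‖ = 1) (hζ₀ : ‖ζ₀‖ = 1) {r : ℝ}
    (hr : 0 < r) (hr1 : r < 1) :
    ‖(ζ - r * ζ₀) ^ (-2 : ℤ) - (ζ - ζ₀ / r) ^ (-2 : ℤ)‖ ≤ 2 * (1 - r ^ 2) / ‖ζ - r * ζ₀‖ ^ 3 := by
  have hr' : (r : ℂ) ≠ 0 := by exact_mod_cast hr.ne'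
  set d := ‖ζ - r * ζ₀‖ with hd
  have hn : ‖ζ - ζ₀ / r‖ = d / r := norm_sub_inv_smul_of_mem_sphere hζ hζ₀ hr
  have hd0 : 0 < d := by
    rw [hd, norm_pos_iff, sub_ne_zero]
    intro h
    rw [h, norm_mul, hζ₀, Complex.norm_real, Real.norm_of_nonneg hr.le] at hζ
    linarith
  have ha : ζ - r * ζ₀ ≠ 0 := norm_pos_iff.1 hd0
  have hb : ζ - ζ₀ / r ≠ 0 := norm_pos_iff.1 (by rw [hn]; positivity)
  -- `a⁻² - b⁻² = (b - a)(a + b) / (a² b²)`: the factor `b - a` yields `1 - r²`, and `a + b` cancels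
  -- one power of `d`.
  have h1 : (ζ - r * ζ₀) ^ (-2 : ℤ) - (ζ - ζ₀ / r) ^ (-2 : ℤ) =
      (r * ζ₀ - ζ₀ / r) * ((ζ - r * ζ₀) + (ζ - ζ₀ / r)) /
        ((ζ - r * ζ₀) ^ 2 * (ζ - ζ₀ / r) ^ 2) := by
    rw [show (-2 : ℤ) = -(2 : ℕ) by rfl, zpow_neg, zpow_natCast, zpow_neg, zpow_natCast,
      inv_sub_inv (pow_ne_zero 2 ha) (pow_ne_zero 2 hb)]
    congr 1
    ring
  have h2 : ‖(r : ℂ) * ζ₀ - ζ₀ / r‖ = (1 - r ^ 2) / r := by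
    have : (r : ℂ) * ζ₀ - ζ₀ / r = (((r ^ 2 - 1) / r : ℝ) : ℂ) * ζ₀ := by
      push_cast; field_simp
    rw [this, norm_mul, hζ₀, mul_one, Complex.norm_real, Real.norm_eq_abs, abs_div, abs_of_pos hr,
      abs_of_nonpos (by nlinarith)]
    ring
  rw [h1, norm_div, norm_mul, norm_mul, norm_pow, norm_pow, h2, hn, ← hd]
  have h3 : ‖(ζ - r * ζ₀) + (ζ - ζ₀ / r)‖ ≤ d * (1 + r) / r := by
    refine (norm_add_le _ _).trans (le_of_eq ?_)
    rw [hn, ← hd]; field_simp; ring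
  have h4 : 0 < 1 - r ^ 2 := by nlinarith
  calc (1 - r ^ 2) / r * ‖(ζ - r * ζ₀) + (ζ - ζ₀ / r)‖ / (d ^ 2 * (d / r) ^ 2)
      ≤ (1 - r ^ 2) / r * (d * (1 + r) / r) / (d ^ 2 * (d / r) ^ 2) := by gcongr
    _ = (1 + r) * (1 - r ^ 2) / d ^ 3 := by field_simp
    _ ≤ 2 * (1 - r ^ 2) / d ^ 3 := by gcongr; linarith

/-- The reflected point lies outside the closed disk, so its kernel contributes nothing to the
integral, yet subtracting it gains the decay `1 - r²`. -/
theorem DiffContOnCl.circleIntegral_cauchyKernel_sub_reflected {F : ℂ → ℂ}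
    (hF : DiffContOnCl ℂ F (Metric.ball 0 1)) {ζ₀ : ℂ} (hζ₀ : ‖ζ₀‖ = 1) {r : ℝ} (hr : 0 < r)
    (hr1 : r < 1) :
    (∮ z in C(0, 1), ((z - r * ζ₀) ^ (-2 : ℤ) - (z - ζ₀ / r) ^ (-2 : ℤ)) * F z) =
      2 * Real.pi * Complex.I * deriv F (r * ζ₀) := by
  have hw : (r : ℂ) * ζ₀ ∈ Metric.ball (0 : ℂ) 1 := by
    rw [mem_ball_zero_iff, norm_mul, hζ₀, Complex.norm_real, Real.norm_of_nonneg hr.le]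
    linarith
  have hv : ∀ z ∈ Metric.closedBall (0 : ℂ) 1, z - ζ₀ / r ≠ 0 := by
    intro z hz h
    rw [sub_eq_zero.1 h, mem_closedBall_zero_iff, norm_div, hζ₀, Complex.norm_real,
      Real.norm_of_nonneg hr.le, div_le_one hr] at hz
    linarith
  have hwne : ∀ z ∈ Metric.sphere (0 : ℂ) 1, z - r * ζ₀ ≠ 0 := fun z hz h => by
    rw [sub_eq_zero.1 h] at hz
    exact (Metric.mem_ball.1 hw).ne (Metric.mem_sphere.1 hz)
  have hcl : closure (Metric.ball (0 : ℂ) 1) = Metric.closedBall 0 1 := closure_ball 0 one_ne_zero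
  have hcont : ContinuousOn F (Metric.closedBall 0 1) := hcl ▸ hF.continuousOn
  have hk : DiffContOnCl ℂ (fun z => (z - ζ₀ / r) ^ (-2 : ℤ)) (Metric.ball 0 1) := by
    refine DifferentiableOn.diffContOnCl fun z hz => ?_
    rw [hcl] at hz
    exact DifferentiableAt.differentiableWithinAt (DifferentiableAt.zpow (f := fun y => y - ζ₀ / r)
      (by fun_prop) (Or.inl (hv z hz)))
  have h2 : (∮ z in C(0, 1), (z - ζ₀ / r) ^ (-2 : ℤ) * F z) = 0 :=
    (hk.smul hF).circleIntegral_eq_zero zero_le_one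
  have hi1 : CircleIntegrable (fun z => (z - r * ζ₀) ^ (-2 : ℤ) * F z) 0 1 :=
    ((ContinuousOn.zpow₀ (by fun_prop) _ fun z hz => Or.inl (hwne z hz)).mul
      (hcont.mono Metric.sphere_subset_closedBall)).circleIntegrable zero_le_one
  have hi2 : CircleIntegrable (fun z => (z - ζ₀ / r) ^ (-2 : ℤ) * F z) 0 1 :=
    ((hcl ▸ (hk.smul hF).continuousOn).mono
      Metric.sphere_subset_closedBall).circleIntegrable zero_le_one
  simp only [sub_mul]
  rw [circleIntegral.integral_sub hi1 hi2, h2, sub_zero, hF.circleIntegral_sub_zpow_neg_two_mul hw]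

/-- If a function analytic in the disk and continuous up to the boundary is `o(|ζ - ζ₀|)` along
the circle at a boundary point `ζ₀`, then its derivative has radial limit `0` there. -/
theorem DiffContOnCl.tendsto_deriv_radial_zero {F : ℂ → ℂ}
    (hF : DiffContOnCl ℂ F (Metric.ball 0 1)) {ζ₀ : ℂ} (hζ₀ : ‖ζ₀‖ = 1)
    (ho : ∀ ε > 0, ∃ δ > 0, ∀ ζ : ℂ, ‖ζ‖ = 1 → ‖ζ - ζ₀‖ < δ → ‖F ζ‖ ≤ ε * ‖ζ - ζ₀‖) :
    Tendsto (fun r : ℝ => deriv F (r * ζ₀)) (𝓝[<] 1) (𝓝 0) := by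
  have hcl : closure (Metric.ball (0 : ℂ) 1) = Metric.closedBall 0 1 := closure_ball 0 one_ne_zero
  have hcont : ContinuousOn F (Metric.closedBall 0 1) := hcl ▸ hF.continuousOn
  obtain ⟨M, hM⟩ := (isCompact_closedBall (0 : ℂ) 1).exists_bound_of_continuousOn hcont
  have hM0 : 0 ≤ M := (norm_nonneg _).trans (hM 0 (by simp))
  have key : ∀ ε > 0, ∃ C : ℝ, ∀ r : ℝ, 0 < r → r < 1 →
      ‖deriv F (r * ζ₀)‖ ≤ 4 * ε + C * (1 - r ^ 2) := by
    intro ε hε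
    obtain ⟨δ, hδ, hδF⟩ := ho ε hε
    -- Near `ζ₀` the bound `‖F ζ‖ ≤ 2 ε d` leaves `4 ε` times the Poisson kernel, of total mass
    -- `2π`. Elsewhere `d ≥ δ / 2`, and `2 M / (δ / 2)³` gives this constant.
    refine ⟨16 * M / δ ^ 3, fun r hr hr1 => ?_⟩
    have h1r : 0 < 1 - r ^ 2 := by nlinarith
    have hw : (r : ℂ) * ζ₀ ∈ Metric.ball (0 : ℂ) 1 := by
      rw [mem_ball_zero_iff, norm_mul, hζ₀, Complex.norm_real, Real.norm_of_nonneg hr.le]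
      linarith
    have hwn : ‖(r : ℂ) * ζ₀‖ = r := by
      rw [norm_mul, hζ₀, Complex.norm_real, Real.norm_of_nonneg hr.le, mul_one]
    have hP : ∫ θ in (0 : ℝ)..2 * Real.pi, poissonKernel 0 (r * ζ₀) (circleMap 0 1 θ) =
        2 * Real.pi := by
      have h1 := (diffContOnCl_const (c := (1 : ℂ)) (𝕜 := ℂ) (E := ℂ)
        (s := Metric.ball (0 : ℂ) 1)).circleAverage_poissonKernel_smul hw
      rw [Real.circleAverage_def] at h1
      simp only [Pi.smul_apply', intervalIntegral.integral_smul_const] at h1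
      rw [smul_smul, Complex.real_smul, mul_one] at h1
      have h2 : (2 * Real.pi)⁻¹ * ∫ θ in (0 : ℝ)..2 * Real.pi,
          poissonKernel 0 (r * ζ₀) (circleMap 0 1 θ) = 1 := by exact_mod_cast h1
      have hπ := Real.pi_pos
      field_simp at h2
      linarith
    have hpt : ∀ ζ : ℂ, ‖ζ‖ = 1 →
        ‖((ζ - r * ζ₀) ^ (-2 : ℤ) - (ζ - ζ₀ / r) ^ (-2 : ℤ)) * F ζ‖ ≤
          4 * ε * poissonKernel 0 (r * ζ₀) ζ + 16 * M / δ ^ 3 * (1 - r ^ 2) := by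
      intro ζ hζ
      have hK := norm_cauchyKernel_sub_reflected_le hζ hζ₀ hr hr1
      rw [norm_mul]
      have hPk : poissonKernel 0 (r * ζ₀) ζ = (1 - r ^ 2) / ‖ζ - r * ζ₀‖ ^ 2 := by
        rw [poissonKernel_def, sub_zero, sub_zero, hwn, hζ]; norm_num
      rw [hPk]
      set d := ‖ζ - r * ζ₀‖ with hd
      have hdr : 1 - r ≤ d := by
        have := norm_sub_norm_le ζ (r * ζ₀)
        rw [hζ, hwn] at this
        exact this
      have hd0 : 0 < d := by linarith
      -- Triangle inequality through `r ζ₀`, whose distance `1 - r` from `ζ₀` is at most `d`.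
      have hζd : ‖ζ - ζ₀‖ ≤ 2 * d := by
        have h1 : ζ - ζ₀ = (ζ - r * ζ₀) + ((r - 1 : ℝ) : ℂ) * ζ₀ := by push_cast; ring
        have h2 : ‖((r - 1 : ℝ) : ℂ) * ζ₀‖ = 1 - r := by
          rw [norm_mul, hζ₀, Complex.norm_real, Real.norm_of_nonpos (by linarith)]; ring
        have h3 := norm_add_le (ζ - r * ζ₀) (((r - 1 : ℝ) : ℂ) * ζ₀)
        rw [← h1, h2, ← hd] at h3
        linarith
      by_cases hδ' : ‖ζ - ζ₀‖ < δ
      · have hR : ‖F ζ‖ ≤ ε * (2 * d) := (hδF ζ hζ hδ').trans (by gcongr)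
        calc _ ≤ 2 * (1 - r ^ 2) / d ^ 3 * (ε * (2 * d)) := by gcongr
          _ = 4 * ε * ((1 - r ^ 2) / d ^ 2) := by field_simp; ring
          _ ≤ _ := le_add_of_nonneg_right (by positivity)
      · have hdδ : δ / 2 ≤ d := by linarith
        have hR : ‖F ζ‖ ≤ M := hM ζ (by simp [hζ])
        calc _ ≤ 2 * (1 - r ^ 2) / (δ / 2) ^ 3 * M := by
              gcongr
              exact hK.trans (by gcongr)
          _ = 16 * M / δ ^ 3 * (1 - r ^ 2) := by field_simp; ring
          _ ≤ _ := le_add_of_nonneg_left (by positivity)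
    have hPc : Continuous fun θ : ℝ => poissonKernel 0 (r * ζ₀) (circleMap 0 1 θ) := by
      simp only [poissonKernel_def, sub_zero]
      refine Continuous.div (by fun_prop) (by fun_prop) fun θ h => ?_
      have h1 : circleMap 0 1 θ = r * ζ₀ := by simpa [sub_eq_zero] using h
      have h2 : ‖circleMap 0 1 θ‖ = 1 := by simp
      rw [h1, hwn] at h2
      linarith
    have hint := intervalIntegral.norm_integral_le_of_norm_le (μ := volume) (a := 0)
      (b := 2 * Real.pi) (f := fun θ => deriv (circleMap 0 1) θ •
        (((circleMap 0 1 θ - r * ζ₀) ^ (-2 : ℤ) - (circleMap 0 1 θ - ζ₀ / r) ^ (-2 : ℤ)) *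
          F (circleMap 0 1 θ)))
      (g := fun θ => 4 * ε * poissonKernel 0 (r * ζ₀) (circleMap 0 1 θ) +
        16 * M / δ ^ 3 * (1 - r ^ 2)) (by positivity)
      (Eventually.of_forall fun θ _ => by
        rw [norm_smul, deriv_circleMap, norm_mul, Complex.norm_I]
        simpa using hpt (circleMap 0 1 θ) (by simp))
      ((by fun_prop : Continuous _).intervalIntegrable _ _)
    have heq := hF.circleIntegral_cauchyKernel_sub_reflected hζ₀ hr hr1
    rw [circleIntegral] at heq
    rw [heq, intervalIntegral.integral_add ((by fun_prop : Continuous _).intervalIntegrable _ _)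
      ((by fun_prop : Continuous _).intervalIntegrable _ _), intervalIntegral.integral_const_mul, hP,
      intervalIntegral.integral_const] at hint
    simp only [norm_mul, Complex.norm_I, Complex.norm_real, Complex.norm_ofNat, mul_one, sub_zero,
      smul_eq_mul, Real.norm_of_nonneg Real.pi_pos.le] at hint
    have hπ := Real.pi_pos
    refine le_of_mul_le_mul_left ?_ (by positivity : (0 : ℝ) < 2 * Real.pi)
    linarith
  rw [Metric.tendsto_nhds]
  intro ε hε
  obtain ⟨C, hC⟩ := key (ε / 8) (by positivity)
  have hlim : Tendsto (fun r : ℝ => C * (1 - r ^ 2)) (𝓝[<] 1) (𝓝 0) := by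
    have : ContinuousAt (fun r : ℝ => C * (1 - r ^ 2)) 1 := by fun_prop
    have h := this.tendsto
    simp only [one_pow, sub_self, mul_zero] at h
    exact h.mono_left nhdsWithin_le_nhds
  filter_upwards [hlim.eventually (gt_mem_nhds (by positivity : (0 : ℝ) < ε / 2)),
    self_mem_nhdsWithin, mem_nhdsWithin_of_mem_nhds (lt_mem_nhds (zero_lt_one (α := ℝ)))]
    with r h1 h2 h3
  rw [dist_zero_right]
  have := hC r h3 h2
  linarith

/-! ### The primitive, continuous up to the boundary -/

section Primitive

/-- The primitive `z ↦ ∑ cₙ z^(n+1) / (n+1)` of `hardyMap c`. -/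
noncomputable def hardyPrimitive (c : EllTwo) : ℂ → ℂ :=
  fun z => ∑' n : ℕ, c n * z ^ (n + 1) / (n + 1)

/-- By the arithmetic–geometric mean inequality. This gives the primitive's series uniform
convergence on the closed disk. -/
theorem summable_norm_div_succ (c : EllTwo) : Summable fun n : ℕ => ‖c n‖ / (n + 1) := by
  have h1 : Summable fun n : ℕ => 1 / ((n : ℝ) + 1) ^ 2 := by
    have := (summable_nat_add_iff 1).2 (Real.summable_one_div_nat_pow.2 one_lt_two)
    simpa using this
  refine Summable.of_nonneg_of_le (fun n => by positivity) (fun n => ?_)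
    ((EllTwo.hasSum_sq c).summable.add h1)
  have h2 : ‖c n‖ / (n + 1) = ‖c n‖ * (1 / ((n : ℝ) + 1)) := by ring
  have h3 : 1 / ((n : ℝ) + 1) ^ 2 = (1 / ((n : ℝ) + 1)) ^ 2 := by rw [one_div_pow]
  rw [h2, h3]
  nlinarith [sq_nonneg (‖c n‖ - 1 / ((n : ℝ) + 1)), sq_nonneg ‖c n‖,
    sq_nonneg (1 / ((n : ℝ) + 1))]

theorem norm_hardyPrimitive_term_le (c : EllTwo) (n : ℕ) {z : ℂ}
    (hz : z ∈ Metric.closedBall (0 : ℂ) 1) :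
    ‖c n * z ^ (n + 1) / (n + 1)‖ ≤ ‖c n‖ / (n + 1) := by
  have h1 : ‖(n : ℂ) + 1‖ = n + 1 := by exact_mod_cast Complex.norm_natCast (n + 1)
  rw [norm_div, norm_mul, norm_pow, h1]
  gcongr
  exact mul_le_of_le_one_right (norm_nonneg _)
    (pow_le_one₀ (norm_nonneg _) (mem_closedBall_zero_iff.1 hz))

theorem hasSum_hardyPrimitive (c : EllTwo) {z : ℂ} (hz : z ∈ Metric.closedBall (0 : ℂ) 1) :
    HasSum (fun n : ℕ => c n * z ^ (n + 1) / (n + 1)) (hardyPrimitive c z) :=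
  (Summable.of_norm_bounded (summable_norm_div_succ c)
    fun n => norm_hardyPrimitive_term_le c n hz).hasSum

theorem diffContOnCl_hardyPrimitive (c : EllTwo) :
    DiffContOnCl ℂ (hardyPrimitive c) (Metric.ball 0 1) := by
  refine ⟨?_, ?_⟩
  · exact Complex.differentiableOn_tsum_of_summable_norm (summable_norm_div_succ c)
      (fun n => by fun_prop) Metric.isOpen_ball
      fun n z hz => norm_hardyPrimitive_term_le c n (Metric.ball_subset_closedBall hz)
  · rw [closure_ball 0 one_ne_zero]
    exact continuousOn_tsum (fun n => by fun_prop) (summable_norm_div_succ c)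
      fun n z hz => norm_hardyPrimitive_term_le c n hz

theorem deriv_hardyPrimitive (c : EllTwo) {z : ℂ} (hz : z ∈ Metric.ball (0 : ℂ) 1) :
    deriv (hardyPrimitive c) z = hardyMap c z := by
  have h := Complex.hasSum_deriv_of_summable_norm (summable_norm_div_succ c)
    (F := fun (n : ℕ) z => c n * z ^ (n + 1) / (n + 1))
    (fun n => by fun_prop) Metric.isOpen_ball
    (fun n z hz => norm_hardyPrimitive_term_le c n (Metric.ball_subset_closedBall hz)) hz
  refine h.tsum_eq.symm.trans (tsum_congr fun n => ?_)
  have hn : (n : ℂ) + 1 ≠ 0 := by exact_mod_cast n.succ_ne_zero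
  have h1 : HasDerivAt (fun z : ℂ => c n * z ^ (n + 1) / (n + 1))
      (c n * (((n + 1 : ℕ) : ℂ) * z ^ n) / (n + 1)) z := by
    simpa using ((hasDerivAt_pow (n + 1) z).const_mul (c n)).div_const ((n : ℂ) + 1)
  rw [h1.deriv]
  push_cast
  field_simp

end Primitive

/-! ### Differentiating the primitive along the circle -/

section Circle

open AddCircle

instance fact_zero_lt_two_pi : Fact (0 < 2 * Real.pi) := ⟨Real.two_pi_pos⟩

theorem quasiMeasurePreserving_mk_two_pi :
    Measure.QuasiMeasurePreserving (fun t : ℝ => (t : AddCircle (2 * Real.pi)))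
      (volume.restrict (Ioc 0 (2 * Real.pi))) haarAddCircle := by
  have h := (AddCircle.measurePreserving_mk (2 * Real.pi) 0).quasiMeasurePreserving
  rw [zero_add] at h
  refine h.mono_right ?_
  rw [volume_eq_smul_haarAddCircle]
  exact Measure.smul_absolutelyContinuous

theorem intervalIntegrable_lp_two (g : Lp ℂ 2 (@haarAddCircle (2 * Real.pi) _)) :
    IntervalIntegrable (fun t : ℝ => g (t : AddCircle (2 * Real.pi))) volume 0 (2 * Real.pi) := by
  rw [intervalIntegrable_iff_integrableOn_Ioc_of_le Real.two_pi_pos.le]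
  have h := AddCircle.measurePreserving_mk (2 * Real.pi) 0
  rw [zero_add] at h
  refine h.integrable_comp_of_integrable ?_
  rw [volume_eq_smul_haarAddCircle]
  exact (integrable_lp_two g).smul_measure ENNReal.ofReal_ne_top

/-- Integration of a square-integrable function on the circle against `i e^{it}` over `(0, θ]` is
an inner product. -/
theorem exists_inner_eq_intervalIntegral {θ : ℝ} (hθ : θ ∈ Icc 0 (2 * Real.pi)) :
    ∃ K : Lp ℂ 2 (@haarAddCircle (2 * Real.pi) _),
      ∀ (g : Lp ℂ 2 (@haarAddCircle (2 * Real.pi) _)) (h : AddCircle (2 * Real.pi) → ℂ),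
        g =ᵐ[haarAddCircle] h → inner ℂ K g = ((2 * Real.pi : ℝ) : ℂ)⁻¹ *
          ∫ t in (0 : ℝ)..θ, Complex.I * Complex.exp (t * Complex.I) * h t := by
  -- The representing vector is the conjugate of `i e^{it}` cut off at `θ`; the conjugate is undone
  -- by the inner product's first slot.
  set k : ℝ → ℂ := (Iic θ).indicator fun t : ℝ =>
    starRingEnd ℂ (Complex.I * Complex.exp (t * Complex.I)) with hk
  have hkm : MemLp k 2 (volume.restrict (Ioc 0 (0 + 2 * Real.pi))) := by
    refine MemLp.of_bound (C := 1) ?_ (Eventually.of_forall fun t => ?_)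
    · exact ((by fun_prop : Continuous fun t : ℝ =>
        starRingEnd ℂ (Complex.I * Complex.exp (t * Complex.I))).stronglyMeasurable.indicator
          measurableSet_Iic).aestronglyMeasurable
    · refine (norm_indicator_le_norm_self _ _).trans ?_
      simp [Complex.norm_exp_ofReal_mul_I]
  have hK : MemLp (AddCircle.liftIoc (2 * Real.pi) 0 k) 2 (@haarAddCircle (2 * Real.pi) _) :=
    memLp_haarAddCircle_iff.2 hkm.memLp_liftIoc
  refine ⟨hK.toLp _, fun g h hgh => ?_⟩
  have h1 : inner ℂ (hK.toLp _) g = ∫ x, h x * starRingEnd ℂ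
      (AddCircle.liftIoc (2 * Real.pi) 0 k x) ∂haarAddCircle := by
    rw [L2.inner_def]
    refine integral_congr_ae ?_
    filter_upwards [hgh, hK.coeFn_toLp] with x hx hx'
    rw [hx, hx', RCLike.inner_apply]
  rw [h1, integral_haarAddCircle, ← AddCircle.integral_preimage (2 * Real.pi) 0, zero_add,
    Complex.real_smul, Complex.ofReal_inv, intervalIntegral.integral_of_le hθ.1]
  congr 1
  have h2 : Ioc 0 (2 * Real.pi) ∩ Iic θ = Ioc 0 θ := by
    rw [Ioc_inter_Iic, min_eq_right hθ.2]
  rw [← h2, ← setIntegral_indicator measurableSet_Iic]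
  refine setIntegral_congr_fun measurableSet_Ioc fun t ht => ?_
  rw [AddCircle.liftIoc_coe_apply (by rwa [zero_add]), hk]
  by_cases hte : t ∈ Iic θ
  · rw [indicator_of_mem hte, indicator_of_mem hte, Complex.conj_conj, mul_comm]
  · rw [indicator_of_notMem hte, indicator_of_notMem hte, map_zero, mul_zero]

theorem integral_I_mul_exp_mul_fourier (n : ℕ) (θ : ℝ) :
    ∫ t in (0 : ℝ)..θ, Complex.I * Complex.exp (t * Complex.I) *
        fourier (n : ℤ) (t : AddCircle (2 * Real.pi)) =
      (Complex.exp (θ * Complex.I) ^ (n + 1) - 1) / (n + 1) := by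
  have hn : (n : ℂ) + 1 ≠ 0 := by exact_mod_cast n.succ_ne_zero
  have hc : ((n : ℂ) + 1) * Complex.I ≠ 0 := mul_ne_zero hn Complex.I_ne_zero
  have hπ : (Real.pi : ℂ) ≠ 0 := by exact_mod_cast Real.pi_ne_zero
  have h1 : ∀ t : ℝ, Complex.I * Complex.exp (t * Complex.I) *
      fourier (n : ℤ) (t : AddCircle (2 * Real.pi)) =
        Complex.I * Complex.exp (((n : ℂ) + 1) * Complex.I * t) := by
    intro t
    rw [fourier_coe_apply, mul_assoc, ← Complex.exp_add]
    congr 2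
    push_cast
    field_simp
    ring
  simp only [h1]
  rw [intervalIntegral.integral_const_mul, integral_exp_mul_complex hc, ← Complex.exp_nat_mul]
  have h2 : ((n : ℂ) + 1) * Complex.I * θ = ((n + 1 : ℕ) : ℂ) * (θ * Complex.I) := by
    push_cast; ring
  rw [h2, Complex.ofReal_zero, mul_zero, Complex.exp_zero]
  field_simp

/-- Termwise integration of an `L²`-convergent series, justified because the integral is a
continuous functional on `L²`. -/
theorem integral_hardyBoundary (c : EllTwo) {θ : ℝ} (hθ : θ ∈ Icc 0 (2 * Real.pi)) :
    ∫ t in (0 : ℝ)..θ, Complex.I * Complex.exp (t * Complex.I) *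
        hardyBoundary (2 * Real.pi) c (t : AddCircle (2 * Real.pi)) =
      hardyPrimitive c (Complex.exp (θ * Complex.I)) - hardyPrimitive c 1 := by
  obtain ⟨K, hK⟩ := exists_inner_eq_intervalIntegral hθ
  have h2π : ((2 * Real.pi : ℝ) : ℂ) ≠ 0 := by exact_mod_cast Real.two_pi_pos.ne'
  have h1 := (hasSum_hardyBoundary (T := 2 * Real.pi) c).mapL (innerSL ℂ K)
  have h2 := ((hasSum_hardyPrimitive c (z := Complex.exp (θ * Complex.I))
    (by simp [Complex.norm_exp_ofReal_mul_I])).sub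
      (hasSum_hardyPrimitive c (z := 1) (by simp))).mul_left (((2 * Real.pi : ℝ) : ℂ)⁻¹)
  have h3 := h1.unique (h2.congr_fun fun n => by
    rw [map_smul, innerSL_apply_apply, hK _ _ (coeFn_fourierLp 2 (n : ℤ)),
      integral_I_mul_exp_mul_fourier, smul_eq_mul]
    ring)
  rw [innerSL_apply_apply, hK _ _ (EventuallyEq.refl _ _)] at h3
  exact mul_left_cancel₀ (inv_ne_zero h2π) h3

theorem ae_hasDerivAt_hardyPrimitive_circle (c : EllTwo) :
    ∀ᵐ θ : ℝ ∂(volume.restrict (Ioc 0 (2 * Real.pi))),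
      HasDerivAt (fun t : ℝ => hardyPrimitive c (Complex.exp (t * Complex.I)))
        (Complex.I * Complex.exp (θ * Complex.I) *
          hardyBoundary (2 * Real.pi) c (θ : AddCircle (2 * Real.pi))) θ := by
  have hint : IntervalIntegrable (fun t : ℝ => Complex.I * Complex.exp (t * Complex.I) *
      hardyBoundary (2 * Real.pi) c (t : AddCircle (2 * Real.pi))) volume 0 (2 * Real.pi) :=
    (intervalIntegrable_lp_two _).continuousOn_mul (by fun_prop)
  -- The integral formula is available only on `[0, 2π]`, so differentiating needs an interior
  -- point.
  have hne : ∀ᵐ θ : ℝ, θ ≠ 2 * Real.pi := by simp [ae_iff, measure_singleton]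
  rw [ae_restrict_iff' measurableSet_Ioc]
  filter_upwards [hint.ae_hasDerivAt_integral, hne] with θ hθ hθne hmem
  rw [uIcc_of_le Real.two_pi_pos.le] at hθ
  have hd := (hθ (Ioc_subset_Icc_self hmem) 0 (left_mem_Icc.2 Real.two_pi_pos.le)).add_const
    (hardyPrimitive c 1)
  refine hd.congr_of_eventuallyEq ?_
  filter_upwards [Ioo_mem_nhds hmem.1 (lt_of_le_of_ne hmem.2 hθne)] with t ht
  rw [integral_hardyBoundary c (Ioo_subset_Icc_self ht), sub_add_cancel]

end Circle

/-! ### Fatou's theorem and the conclusion -/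

theorem abs_le_pi_div_two_mul_norm_exp_sub_one {s : ℝ} (hs : |s| ≤ Real.pi) :
    |s| ≤ Real.pi / 2 * ‖Complex.exp (s * Complex.I) - 1‖ := by
  have h1 := Real.mul_abs_le_abs_sin (x := s / 2) (by rw [abs_div, abs_two]; linarith)
  have h2 := Complex.norm_exp_I_mul_ofReal_sub_one s
  rw [mul_comm (s : ℂ), h2, norm_mul, Real.norm_ofNat, Real.norm_eq_abs]
  have hπ := Real.pi_pos
  rw [abs_div, abs_two] at h1
  calc |s| = Real.pi * (2 / Real.pi * (|s| / 2)) := by field_simp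
    _ ≤ Real.pi * |Real.sin (s / 2)| := by gcongr
    _ = _ := by ring

/-- Where the boundary values of an analytic function are differentiable along the circle, its
derivative has a radial limit. -/
theorem DiffContOnCl.tendsto_deriv_radial {F : ℂ → ℂ} (hF : DiffContOnCl ℂ F (Metric.ball 0 1))
    {θ : ℝ} {w : ℂ} (hd : HasDerivAt (fun t : ℝ => F (Complex.exp (t * Complex.I)))
      (Complex.I * Complex.exp (θ * Complex.I) * w) θ) :
    Tendsto (fun r : ℝ => deriv F (r * Complex.exp (θ * Complex.I))) (𝓝[<] 1) (𝓝 w) := by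
  set ζ₀ := Complex.exp (θ * Complex.I) with hζ₀
  have hn : ‖ζ₀‖ = 1 := Complex.norm_exp_ofReal_mul_I θ
  -- Subtracting the affine part makes the boundary values `o(|ζ - ζ₀|)` and lowers the derivative
  -- by exactly `w`.
  set R : ℂ → ℂ := fun z => F z - (F ζ₀ + w * (z - ζ₀)) with hR
  have hlin : Differentiable ℂ fun z => F ζ₀ + w * (z - ζ₀) := by fun_prop
  have hRd : DiffContOnCl ℂ R (Metric.ball 0 1) := hF.sub hlin.diffContOnCl
  have hexp : HasDerivAt (fun t : ℝ => Complex.exp (t * Complex.I)) (Complex.I * ζ₀) θ := by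
    have := ((Complex.ofRealCLM.hasDerivAt (x := θ)).mul_const Complex.I).cexp
    simpa [mul_comm, hζ₀] using this
  have hR0 : HasDerivAt (fun t : ℝ => R (Complex.exp (t * Complex.I))) 0 θ := by
    have := hd.sub (((hexp.sub_const ζ₀).const_mul w).const_add (F ζ₀))
    rwa [mul_comm w, sub_self] at this
  have ho : ∀ ε > 0, ∃ δ > 0, ∀ ζ : ℂ, ‖ζ‖ = 1 → ‖ζ - ζ₀‖ < δ → ‖R ζ‖ ≤ ε * ‖ζ - ζ₀‖ := by
    intro ε hε
    have hπ := Real.pi_pos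
    -- The factor `2 / π` offsets the loss `π / 2` in passing from arc length to chord length.
    have h1 := (hasDerivAt_iff_isLittleO.1 hR0).def (c := ε * (2 / Real.pi)) (by positivity)
    obtain ⟨δ, hδ, hδR⟩ := Metric.eventually_nhds_iff.1 h1
    refine ⟨δ * (2 / Real.pi), by positivity, fun ζ hζ hlt => ?_⟩
    -- The signed angle from `ζ₀` to `ζ`, so that `θ + s` is an angle of `ζ` close to `θ`.
    set s := Complex.arg (ζ / ζ₀) with hs
    have hζ₀0 : ζ₀ ≠ 0 := Complex.exp_ne_zero _
    have hes : Complex.exp (s * Complex.I) = ζ / ζ₀ := by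
      have := Complex.norm_mul_exp_arg_mul_I (ζ / ζ₀)
      rwa [norm_div, hζ, hn, div_one, Complex.ofReal_one, one_mul] at this
    have hsπ := abs_le_pi_div_two_mul_norm_exp_sub_one (Complex.abs_arg_le_pi (ζ / ζ₀))
    rw [← hs, hes] at hsπ
    have hdist : ‖ζ / ζ₀ - 1‖ = ‖ζ - ζ₀‖ := by
      rw [div_sub_one hζ₀0, norm_div, hn, div_one]
    rw [hdist] at hsπ
    have hζe : Complex.exp ((θ + s : ℝ) * Complex.I) = ζ := by
      rw [Complex.ofReal_add, add_mul, Complex.exp_add, hes, ← hζ₀, mul_div_cancel₀ _ hζ₀0]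
    have h2 := @hδR (θ + s) (by
      rw [Real.dist_eq, add_sub_cancel_left]
      refine hsπ.trans_lt ?_
      calc Real.pi / 2 * ‖ζ - ζ₀‖ < Real.pi / 2 * (δ * (2 / Real.pi)) := by gcongr
        _ = δ := by field_simp)
    have hRζ₀ : R ζ₀ = 0 := by simp [hR]
    rw [hζe, ← hζ₀, hRζ₀, smul_zero, sub_zero, sub_zero, add_sub_cancel_left,
      Real.norm_eq_abs] at h2
    refine h2.trans ?_
    calc ε * (2 / Real.pi) * |s| ≤ ε * (2 / Real.pi) * (Real.pi / 2 * ‖ζ - ζ₀‖) := by gcongr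
      _ = ε * ‖ζ - ζ₀‖ := by field_simp
  have hlim := (hRd.tendsto_deriv_radial_zero hn ho).add_const w
  rw [zero_add] at hlim
  refine hlim.congr' ?_
  filter_upwards [self_mem_nhdsWithin,
    mem_nhdsWithin_of_mem_nhds (lt_mem_nhds (zero_lt_one (α := ℝ)))] with r hr1 hr0
  have hmem : (r : ℂ) * ζ₀ ∈ Metric.ball (0 : ℂ) 1 := by
    rw [mem_ball_zero_iff, norm_mul, hn, Complex.norm_real, Real.norm_of_nonneg hr0.le, mul_one]
    exact hr1
  have hFd := (hF.differentiableAt Metric.isOpen_ball hmem).hasDerivAt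
  have hLd : HasDerivAt (fun z => F ζ₀ + w * (z - ζ₀)) w (r * ζ₀) := by
    simpa using (((hasDerivAt_id ((r : ℂ) * ζ₀)).sub_const ζ₀).const_mul w).const_add (F ζ₀)
  have hRw : HasDerivAt R (deriv F (r * ζ₀) - w) (r * ζ₀) := hFd.sub hLd
  rw [hRw.deriv, sub_add_cancel]

/-- **Fatou's theorem** for the Hardy space: radial limits exist almost everywhere and are given by
the boundary function. -/
theorem ae_tendsto_hardyMap_radial (c : EllTwo) :
    ∀ᵐ θ : ℝ ∂(volume.restrict (Ioc 0 (2 * Real.pi))),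
      Tendsto (fun r : ℝ => hardyMap c (r * Complex.exp (θ * Complex.I))) (𝓝[<] 1)
        (𝓝 (hardyBoundary (2 * Real.pi) c (θ : AddCircle (2 * Real.pi)))) := by
  filter_upwards [ae_hasDerivAt_hardyPrimitive_circle c] with θ hθ
  refine ((diffContOnCl_hardyPrimitive c).tendsto_deriv_radial hθ).congr' ?_
  filter_upwards [self_mem_nhdsWithin,
    mem_nhdsWithin_of_mem_nhds (lt_mem_nhds (zero_lt_one (α := ℝ)))] with r hr1 hr0
  refine deriv_hardyPrimitive c ?_
  rw [mem_ball_zero_iff, norm_mul, Complex.norm_exp_ofReal_mul_I, Complex.norm_real,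
    Real.norm_of_nonneg hr0.le, mul_one]
  exact hr1

theorem isInnerFunction_hardyMap {c : EllTwo}
    (hc : ∀ᵐ x ∂(@AddCircle.haarAddCircle (2 * Real.pi) _), ‖hardyBoundary (2 * Real.pi) c x‖ = 1) :
    IsInnerFunction (hardyMap c) := by
  refine ⟨memHardyTwo_hardyMap c, ?_⟩
  filter_upwards [ae_tendsto_hardyMap_radial c, quasiMeasurePreserving_mk_two_pi.ae hc]
    with θ hθ hθ'
  exact ⟨_, hθ', hθ⟩

theorem theorem15 {H : Type*} [NormedAddCommGroup H] [InnerProductSpace ℂ H] [CompleteSpace H]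
    (f : ℕ → H) (hf : IsFrame f) (hli : LinearIndependent ℂ f) :
    (∃ T : H →L[ℂ] H, ∀ n : ℕ, f n = (T ^ n) (f 0)) ↔
      (IsRieszBasis f ∨
        ∃ c : EllTwo, IsInnerFunction (hardyMap c) ∧
          (synthesisOperator f hf).ker =
            (Submodule.span ℂ (Set.range fun n : ℕ => (rightShift ^ n) c)).topologicalClosure) := by
  constructor
  · rintro ⟨T, hT⟩
    by_cases h0 : (synthesisOperator f hf).ker = ⊥
    · exact Or.inl (isRieszBasis_of_ker_eq_bot hf hli h0)
    · have hS : ∀ x ∈ (synthesisOperator f hf).ker, rightShift x ∈ (synthesisOperator f hf).ker := by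
        intro x hx
        have hx' : synthesisOperator f hf x = 0 := hx
        change synthesisOperator f hf (rightShift x) = 0
        rw [synthesisOperator_rightShift hf hT, hx', map_zero]
      obtain ⟨c, hc, hker⟩ := exists_eq_closure_span_rightShift_pow (T := 2 * Real.pi)
        (synthesisOperator f hf).isClosed_ker hS h0
      exact Or.inr ⟨c, isInnerFunction_hardyMap hc, hker⟩
  · intro h
    -- Both alternatives make the kernel shift-invariant: it is zero, or a closed span of all shifts
    -- of one vector.
    refine exists_orbit_of_ker_invariant hf ?_
    rcases h with h | ⟨c, -, hker⟩
    · rw [h.ker_synthesisOperator hf]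
      intro x hx
      rw [(Submodule.mem_bot ℂ).1 hx, map_zero]
      exact Submodule.zero_mem _
    · rw [hker]
      exact fun x hx => rightShift_mem_closure_span c hx
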